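/- There is an absolute constant $c>0$ such that the following holds. Let $d\ge 2$ be an integer and let $H$ be a (finite, simple) $d$-regular graph on a nonempty set $V$ of $n$ vertices. Suppose that for every set $W\subseteq V$ of $w\le n/2$ vertices for which the induced subgraph $H[W]$ is connected, there are at least $c\,w\log_2 d$ edges of $H$ connecting $W$ to its complement $V\setminus W$. Then $m(H)=2^d$, and moreover $H$ has a linear connectivity code with exactly $2^d$ members. Here a connectivity code for $H$ is a collection $\mathcal G$ of spanning subgraphs of $H$ (graphs on the vertex set $V$ all of whose edges are edges of $H$) such that for any two distinct $G,G'\in\mathcal G$ the symmetric difference, that is, the graph on $V$ whose edges are those belonging to exactly one of $G,G'$, is connected (as a graph on all of $V$); $m(H)$ is the maximum cardinality of a connectivity code for $H$. A code is linear if it contains the edgeless graph and is closed under symmetric difference. -/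

import Mathlib

namespace ConnCode

/-- A family `𝒢` of spanning subgraphs of `H` (graphs on the vertex set of `H` all of whose edges
are edges of `H`) is a connectivity code for `H` if the symmetric difference of any two distinct
members is connected, as a graph on the whole vertex set. In the Boolean algebra `SimpleGraph V`,
`symmDiff G G'` is the graph whose edges are those lying in exactly one of `G`, `G'`. -/
def IsConnectivityCode {V : Type*} (H : SimpleGraph V) (𝒢 : Set (SimpleGraph V)) : Prop :=
  (∀ G ∈ 𝒢, G ≤ H) ∧ ∀ G ∈ 𝒢, ∀ G' ∈ 𝒢, G ≠ G' → (symmDiff G G').Connected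

/-- A family of graphs on `V` is linear if the edge sets of its members form a vector space over
the field with two elements: it contains the edgeless graph and is closed under symmetric
difference. -/
def IsLinear {V : Type*} (𝒢 : Set (SimpleGraph V)) : Prop :=
  ⊥ ∈ 𝒢 ∧ ∀ G ∈ 𝒢, ∀ G' ∈ 𝒢, symmDiff G G' ∈ 𝒢

/-- `m(H)`: the maximum cardinality of a connectivity code for the finite graph `H`. -/
noncomputable def maxCodeSize {V : Type*} [Finite V] (H : SimpleGraph V) : ℕ :=
  sSup {k : ℕ | ∃ 𝒢 : Set (SimpleGraph V), IsConnectivityCode H 𝒢 ∧ 𝒢.ncard = k}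

/-- The supremum defining `maxCodeSize` is a genuine, attained maximum. -/
theorem isGreatest_maxCodeSize {V : Type*} [Finite V] (H : SimpleGraph V) :
    IsGreatest {k : ℕ | ∃ 𝒢 : Set (SimpleGraph V), IsConnectivityCode H 𝒢 ∧ 𝒢.ncard = k}
      (maxCodeSize H) := by
  have hne : {k : ℕ | ∃ 𝒢 : Set (SimpleGraph V),
      IsConnectivityCode H 𝒢 ∧ 𝒢.ncard = k}.Nonempty :=
    ⟨0, ∅, ⟨by simp, by simp⟩, by simp⟩
  have hb : BddAbove {k : ℕ | ∃ 𝒢 : Set (SimpleGraph V),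
      IsConnectivityCode H 𝒢 ∧ 𝒢.ncard = k} := by
    refine ⟨(Set.univ : Set (SimpleGraph V)).ncard, ?_⟩
    rintro k ⟨𝒢, -, rfl⟩
    exact Set.ncard_le_ncard (Set.subset_univ _) (Set.toFinite _)
  exact ⟨Nat.sSup_mem hne hb, fun k hk => le_csSup hb hk⟩

end ConnCode

/-! Assign a vector `f e` in `F₂^d` to each edge; for a vector `y` take the subgraph of edges with
`y ⬝ᵥ f e ≠ 0` (`codeword`). This is linear in `y`, so `2^d` codewords arise once every nonzero `y`
gives a connected graph. That holds if the vectors on the boundary of each connected `W` of at most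
half the vertices span (`connected_codeword`). No code is larger, since two members cannot agree at
a vertex (`ncard_le_two_pow_degree`).

For a single vertex its `d` vectors must form a basis, which random vectors do only with constant
probability. So a subgraph `R` with degrees of order `L ≈ log₂ d` is set aside. In `G = H \ R`,
random vectors are dependent at a given vertex with probability at most `2^(-8L)`, and expansion
makes larger boundaries fail to span with probability at most `2^(-8L|W|)`. At most `d^(2(w-1))`
connected `w`-sets contain a given vertex, so a local lemma (`exists_forall_not_of_sum_le`) avoids
all failures. The edges of `R` are then filled in greedily (`LocallyIndependent.exists_extend`),
completing bases at the vertices. -/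

namespace ConnCode

open Finset

/-! ### A local lemma by counting -/

section LocalLemma

variable {E A ι : Type*} [Fintype E] [DecidableEq E] [Fintype A]

open scoped Classical in
/-- Events depending on disjoint sets of coordinates are independent. -/
theorem card_inter_mul_le (S : Finset E) (P Q : (E → A) → Prop)
    (hP : ∀ f g : E → A, (∀ e ∈ S, f e = g e) → P f → P g)
    (hQ : ∀ f g : E → A, (∀ e ∉ S, f e = g e) → Q f → Q g) :
    #{f | P f ∧ Q f} * Fintype.card (E → A) ≤ #{f | P f} * #{f | Q f} := by
  rw [← Finset.card_univ, ← card_product, ← card_product]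
  -- Exchange the coordinates outside `S` between two functions; the exchange is an involution.
  refine card_le_card_of_injOn (fun x => (S.piecewise x.1 x.2, S.piecewise x.2 x.1)) ?_ ?_
  · rintro ⟨f, g⟩ h
    simp only [coe_product, Set.mem_prod, mem_coe, mem_filter_univ] at h ⊢
    refine ⟨hP f _ (fun e he => ?_) h.1.1, hQ f _ (fun e he => ?_) h.1.2⟩ <;> simp [he]
  · rintro ⟨f, g⟩ - ⟨f', g'⟩ - h
    simp only [Prod.mk.injEq, funext_iff] at h ⊢
    constructor <;> intro e <;> have h1 := h.1 e <;> have h2 := h.2 e <;>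
      by_cases he : e ∈ S <;> simp_all

open scoped Classical in
/-- A local lemma for uniformly random functions, proved by counting: if the `i`-th bad event
has probability at most `p i` and depends only on the coordinates in the nonempty set `S i`, then
some function avoids all bad events as soon as `∑ p i / q ^ #(S i) ≤ 1 - q` over the events
involving any given coordinate. -/
theorem exists_forall_not_of_sum_le [Nonempty A] (I : Finset ι) (S : ι → Finset E)
    (B : ι → (E → A) → Prop)
    (hB : ∀ i ∈ I, ∀ f g : E → A, (∀ e ∈ S i, f e = g e) → B i f → B i g)
    (hS : ∀ i ∈ I, (S i).Nonempty) (p : ι → ℝ)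
    (hp : ∀ i ∈ I, ∀ F : Finset (E → A), (∀ f ∈ F, B i f) →
      (#F : ℝ) ≤ p i * Fintype.card (E → A))
    {q : ℝ} (hq : 0 < q) (hq1 : q ≤ 1)
    (hsum : ∀ e, ∑ i ∈ I with e ∈ S i, p i / q ^ #(S i) ≤ 1 - q) :
    ∃ f, ∀ i ∈ I, ¬ B i f := by
  set N : Finset E → Finset (E → A) := fun T => {f | ∀ i ∈ I, S i ⊆ T → ¬ B i f} with hN
  have hcard : (0 : ℝ) < Fintype.card (E → A) := by exact_mod_cast Fintype.card_pos
  have hind : ∀ i ∈ I, ∀ T, (#{f | B i f ∧ f ∈ N (T \ S i)} : ℝ) ≤ p i * #(N (T \ S i)) := by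
    intro i hi T
    have h := card_inter_mul_le (S i) (B i) (fun f => f ∈ N (T \ S i)) (hB i hi) (by
      intro f g hfg hf
      simp only [hN, mem_filter_univ] at hf ⊢
      intro j hj hjT hjg
      refine hf j hj hjT (hB j hj g f (fun e he => (hfg e ?_).symm) hjg)
      exact (mem_sdiff.1 (hjT he)).2)
    have h2 : (#{f | B i f ∧ f ∈ N (T \ S i)} : ℝ) * Fintype.card (E → A)
        ≤ #{f | B i f} * #(N (T \ S i)) := by
      rw [← Nat.cast_mul, ← Nat.cast_mul, Nat.cast_le]
      convert h
      simp [hN]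
    have h3 := mul_le_mul_of_nonneg_right (hp i hi {f | B i f} (by simp)) (Nat.cast_nonneg (α := ℝ) #(N (T \ S i)))
    refine le_of_mul_le_mul_right (h2.trans (h3.trans (le_of_eq ?_))) hcard
    ring
  -- `N T` avoids the events supported inside `T`. Each coordinate added to `T` keeps at least a
  -- fraction `q` of the functions.
  have key : ∀ T : Finset E, ∀ U ⊆ T, q ^ #(T \ U) * (#(N U) : ℝ) ≤ #(N T) := by
    intro T
    induction T using Finset.strongInduction with
    | H T ih =>
    intro U hU
    rcases hU.eq_or_ssubset with rfl | hss
    · simp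
    obtain ⟨e, heT, heU⟩ := exists_of_ssubset hss
    have hT0 : T.erase e ⊂ T := erase_ssubset heT
    have hstep : q * (#(N (T.erase e)) : ℝ) ≤ #(N T) := by
      -- A function lost on adding `e` satisfies some `B i` with `e ∈ S i`, yet still avoids all
      -- events inside `T \ S i`, which are independent of `B i`.
      have hcover : N (T.erase e) ⊆ N T ∪
          (I.filter (fun i => e ∈ S i)).biUnion (fun i => {f | B i f ∧ f ∈ N (T \ S i)}) := by
        intro f hf
        simp only [hN, mem_union, mem_biUnion, mem_filter, mem_univ, true_and] at hf ⊢
        by_contra! hcon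
        obtain ⟨⟨i, hi, hiT, hif⟩, h2⟩ := hcon
        have hei : e ∈ S i := by
          by_contra hei
          exact hf i hi (subset_erase.2 ⟨hiT, hei⟩) hif
        obtain ⟨j, hj, hjT, hjf⟩ := h2 i ⟨hi, hei⟩ hif
        refine hf j hj (fun x hx => mem_erase.2 ⟨?_, (mem_sdiff.1 (hjT hx)).1⟩) hjf
        rintro rfl
        exact (mem_sdiff.1 (hjT hx)).2 hei
      have h1 : (#(N (T.erase e)) : ℝ) ≤ #(N T) +
          ∑ i ∈ I with e ∈ S i, (#{f | B i f ∧ f ∈ N (T \ S i)} : ℝ) := by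
        have := (card_le_card hcover).trans
          ((card_union_le _ _).trans (Nat.add_le_add_left card_biUnion_le _))
        exact_mod_cast this
      have h2 : ∑ i ∈ I with e ∈ S i, (#{f | B i f ∧ f ∈ N (T \ S i)} : ℝ) ≤
          ∑ i ∈ I with e ∈ S i, p i / q ^ #(S i) * #(N (T.erase e)) := by
        refine sum_le_sum fun i hi => ?_
        obtain ⟨hi, hei⟩ := mem_filter.1 hi
        have hp0 : 0 ≤ p i := nonneg_of_mul_nonneg_left
          ((Nat.cast_nonneg _).trans (hp i hi ∅ (by simp))) hcard
        refine (hind i hi T).trans ?_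
        rw [div_mul_eq_mul_div, mul_div_assoc]
        refine mul_le_mul_of_nonneg_left ?_ hp0
        rw [le_div_iff₀ (pow_pos hq _), mul_comm]
        refine le_trans ?_ (ih _ hT0 (T \ S i) ?_)
        · refine mul_le_mul_of_nonneg_right (pow_le_pow_of_le_one hq.le hq1 ?_)
            (Nat.cast_nonneg _)
          refine card_le_card fun x hx => ?_
          simp only [mem_sdiff, mem_erase] at hx
          tauto
        · intro x hx
          simp only [mem_sdiff, mem_erase] at hx ⊢
          exact ⟨fun h => hx.2 (h ▸ hei), hx.1⟩
      rw [← sum_mul] at h2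
      have h3 := mul_le_mul_of_nonneg_right (hsum e)
        (Nat.cast_nonneg (α := ℝ) #(N (T.erase e)))
      linarith
    have hUT : U ⊆ T.erase e := subset_erase.2 ⟨hU, heU⟩
    have hc : #(T \ U) = #(T.erase e \ U) + 1 := by
      rw [card_sdiff_of_subset hU, card_sdiff_of_subset hUT, card_erase_of_mem heT]
      have := card_lt_card hss
      omega
    calc q ^ #(T \ U) * (#(N U) : ℝ) = q * (q ^ #(T.erase e \ U) * (#(N U) : ℝ)) := by
          rw [hc]; ring
      _ ≤ q * #(N (T.erase e)) := mul_le_mul_of_nonneg_left (ih _ hT0 U hUT) hq.le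
      _ ≤ _ := hstep
  have h0 : N ∅ = univ := by
    ext f
    simp only [hN, mem_filter_univ, mem_univ, iff_true]
    intro i hi h
    exact absurd (subset_empty.1 h) (hS i hi).ne_empty
  have hfin := key univ ∅ (empty_subset _)
  rw [h0, Finset.card_univ] at hfin
  have hpos : (0 : ℝ) < #(N univ) := lt_of_lt_of_le (by positivity) hfin
  obtain ⟨f, hf⟩ := card_pos.1 (Nat.cast_pos.1 hpos)
  simp only [hN, mem_filter_univ] at hf
  exact ⟨f, fun i hi => hf i hi (subset_univ _)⟩

end LocalLemma

/-! ### Counting connected vertex sets -/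

section ConnectedSets

variable {V : Type*} [DecidableEq V] (H : SimpleGraph V)

theorem exists_adj_of_connected_induce {W W' : Finset V}
    (hW : (H.induce (W : Set V)).Connected) (hsub : W' ⊂ W) (hne : W'.Nonempty) :
    ∃ x ∈ W', ∃ y ∈ W \ W', H.Adj x y := by
  obtain ⟨v, hv⟩ := hne
  obtain ⟨u, huW, hu⟩ := exists_of_ssubset hsub
  obtain ⟨p⟩ := hW.preconnected ⟨v, hsub.1 hv⟩ ⟨u, huW⟩
  obtain ⟨e, -, he1, he2⟩ := p.exists_boundary_dart {x | (x : V) ∈ W'} hv hu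
  exact ⟨e.fst, he1, e.snd, mem_sdiff.2 ⟨e.snd.2, he2⟩, e.adj⟩

/-- A connected vertex set is the support of a walk that is less than twice as long as the set. -/
theorem exists_walk_support_eq {W : Finset V} (hW : (H.induce (W : Set V)).Connected) {v : V}
    (hv : v ∈ W) :
    ∃ p : H.Walk v v, p.length = 2 * (#W - 1) ∧ p.support.toFinset = W := by
  -- A detour `x → y → x` to a new vertex `y` costs two steps.
  have key : ∀ m < #W, ∃ p : H.Walk v v, p.length = 2 * m ∧ p.support.toFinset ⊆ W ∧
      #p.support.toFinset = m + 1 := by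
    intro m
    induction m with
    | zero => exact fun _ => ⟨.nil, by simp, by simpa using hv, by simp⟩
    | succ m ih =>
      intro hm
      obtain ⟨p, hl, hs, hc⟩ := ih (by omega)
      have hss : p.support.toFinset ⊂ W :=
        hs.ssubset_of_ne (fun h => by rw [h] at hc; omega)
      obtain ⟨x, hx, y, hy, hxy⟩ := exists_adj_of_connected_induce H hW hss ⟨v, by simp⟩
      rw [List.mem_toFinset] at hx
      have hsupp : ((p.takeUntil x hx).append
          (.cons hxy (.cons hxy.symm (p.dropUntil x hx)))).support.toFinset =
          insert y p.support.toFinset := by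
        conv_rhs => rw [← p.take_spec hx]
        ext z
        have := (p.dropUntil x hx).start_mem_support
        simp only [List.mem_toFinset, SimpleGraph.Walk.mem_support_append_iff,
          SimpleGraph.Walk.support_cons, List.mem_cons, mem_insert]
        have hz : z = x → z ∈ (p.dropUntil x hx).support := fun h => h ▸ this
        tauto
      refine ⟨_, ?_, hsupp ▸ insert_subset (mem_sdiff.1 hy).1 hs, ?_⟩
      · have := congrArg SimpleGraph.Walk.length (p.take_spec hx)
        simp only [SimpleGraph.Walk.length_append, SimpleGraph.Walk.length_cons] at this ⊢
        omega
      · rw [hsupp, card_insert_of_notMem (mem_sdiff.1 hy).2, hc]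
  have hpos : 0 < #W := card_pos.2 ⟨v, hv⟩
  obtain ⟨p, hl, hs, hc⟩ := key (#W - 1) (by omega)
  exact ⟨p, hl, eq_of_subset_of_card_le hs (by omega)⟩

variable [Fintype V] [DecidableRel H.Adj]

/-- The supports of the walks of a given length from a given vertex. -/
def walkSupports : ℕ → V → Finset (Finset V)
  | 0, v => {{v}}
  | l + 1, v => (H.neighborFinset v).biUnion fun u => (walkSupports l u).image (insert v)

theorem support_mem_walkSupports {v u : V} (p : H.Walk v u) :
    p.support.toFinset ∈ walkSupports H p.length v := by
  induction p with
  | nil => simp [walkSupports]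
  | cons h p ih =>
    simp only [SimpleGraph.Walk.length_cons, walkSupports, mem_biUnion, mem_image]
    exact ⟨_, (H.mem_neighborFinset _ _).2 h, _, ih, by simp⟩

theorem card_walkSupports_le {d : ℕ} (hd : ∀ v, H.degree v ≤ d) (l : ℕ) (v : V) :
    #(walkSupports H l v) ≤ d ^ l := by
  induction l generalizing v with
  | zero => simp [walkSupports]
  | succ l ih =>
    rw [walkSupports, pow_succ']
    refine (card_biUnion_le_card_mul _ _ (d ^ l) fun u _ => card_image_le.trans (ih u)).trans ?_
    exact Nat.mul_le_mul_right _ (hd v)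

/-- Weighted count of the connected vertex sets containing a given vertex. -/
theorem sum_pow_card_le {d : ℕ} (hd : ∀ v, H.degree v ≤ d) (𝒲 : Finset (Finset V)) (v : V)
    (h𝒲 : ∀ W ∈ 𝒲, v ∈ W ∧ (H.induce (W : Set V)).Connected) {x : ℝ} (hx : 0 ≤ x)
    (hdx : (d : ℝ) ^ 2 * x ≤ 1 / 2) :
    ∑ W ∈ 𝒲, x ^ #W ≤ 2 * x := by
  have hmaps : ∀ W ∈ 𝒲, #W - 1 ∈ range (Fintype.card V) := by
    intro W hW
    have := card_pos.2 ⟨v, (h𝒲 W hW).1⟩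
    have := card_le_univ W
    rw [mem_range]
    omega
  -- Grouping by `j = #W - 1`, there are at most `d ^ (2 * j)` closed-walk supports, giving a
  -- geometric series of ratio `d ^ 2 * x ≤ 1 / 2`.
  rw [← sum_fiberwise_of_maps_to hmaps]
  calc ∑ j ∈ range (Fintype.card V), ∑ W ∈ 𝒲 with #W - 1 = j, x ^ #W
      ≤ ∑ j ∈ range (Fintype.card V), x * (1 / 2) ^ j := by
        refine sum_le_sum fun j _ => ?_
        have h1 : ∑ W ∈ 𝒲 with #W - 1 = j, x ^ #W =
            #{W ∈ 𝒲 | #W - 1 = j} * x ^ (j + 1) := by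
          rw [← nsmul_eq_mul, ← sum_const]
          refine sum_congr rfl fun W hW => ?_
          obtain ⟨hW, hj⟩ := mem_filter.1 hW
          have := card_pos.2 ⟨v, (h𝒲 W hW).1⟩
          congr 1
          omega
        have h2 : #{W ∈ 𝒲 | #W - 1 = j} ≤ d ^ (2 * j) := by
          refine (card_le_card fun W hW => ?_).trans (card_walkSupports_le H hd (2 * j) v)
          obtain ⟨hW, hj⟩ := mem_filter.1 hW
          obtain ⟨p, hp, hpW⟩ := exists_walk_support_eq H (h𝒲 W hW).2 (h𝒲 W hW).1
          rw [← hj, ← hp]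
          nth_rw 1 [← hpW]
          exact support_mem_walkSupports H p
        have h3 : (#{W ∈ 𝒲 | #W - 1 = j} : ℝ) ≤ (d : ℝ) ^ (2 * j) := by exact_mod_cast h2
        rw [h1]
        calc _ ≤ (d : ℝ) ^ (2 * j) * x ^ (j + 1) := by gcongr
          _ = x * ((d : ℝ) ^ 2 * x) ^ j := by rw [mul_pow, ← pow_mul]; ring
          _ ≤ _ := by gcongr
    _ ≤ x * 2 := by
        rw [← mul_sum]
        exact mul_le_mul_of_nonneg_left (sum_geometric_two_le _) hx
    _ = 2 * x := mul_comm _ _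

end ConnectedSets

/-! ### Sparse, nearly regular spanning subgraphs -/

section SparseSubgraph

variable {V : Type*} [Fintype V] [DecidableEq V]

/-- A regular bipartite relation contains a perfect matching. -/
theorem exists_injective_of_regular {t : V → Finset V} {m : ℕ} (hm : 0 < m)
    (h1 : ∀ v, #(t v) = m) (h2 : ∀ u, #{v | u ∈ t v} = m) :
    ∃ f : V → V, Function.Injective f ∧ ∀ v, f v ∈ t v := by
  -- Hall's condition, by double counting the incidences leaving `s`.
  refine (all_card_le_biUnion_card_iff_exists_injective t).1 fun s => ?_
  refine Nat.le_of_mul_le_mul_right (card_mul_le_card_mul (fun v u => u ∈ t v) ?_ ?_) hm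
  · intro v hv
    rw [← h1 v]
    refine card_le_card fun u hu => ?_
    simp only [bipartiteAbove, mem_filter, mem_biUnion]
    exact ⟨⟨v, hv, hu⟩, hu⟩
  · intro u _
    rw [← h2 u]
    exact card_le_card (filter_subset_filter _ (subset_univ s))

/-- Peel off `j` perfect matchings one at a time. -/
theorem exists_regular_subset {k : ℕ} (j : ℕ) {t : V → Finset V}
    (h1 : ∀ v, #(t v) = k + j) (h2 : ∀ u, #{v | u ∈ t v} = k + j) :
    ∃ t' : V → Finset V, (∀ v, t' v ⊆ t v) ∧ (∀ v, #(t' v) = k) ∧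
      ∀ u, #{v | u ∈ t' v} = k := by
  induction j generalizing t with
  | zero => exact ⟨t, fun _ => subset_rfl, h1, h2⟩
  | succ j ih =>
    obtain ⟨f, hf, hft⟩ := exists_injective_of_regular (by omega) h1 h2
    obtain ⟨t', ht', h⟩ := ih (t := fun v => (t v).erase (f v))
      (fun v => by rw [card_erase_of_mem (hft v), h1]; rfl) (fun u => by
        obtain ⟨w, rfl⟩ := Finite.surjective_of_injective hf u
        have : ({v | f w ∈ (t v).erase (f v)} : Finset V) =
            ({v | f w ∈ t v} : Finset V).erase w := by
          ext v
          simp [hf.eq_iff, eq_comm]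
        rw [this, card_erase_of_mem (by simpa using hft w), h2]
        rfl)
    exact ⟨t', fun v => (ht' v).trans (erase_subset _ _), h⟩

open scoped Classical in
/-- A regular graph has spanning subgraphs of every smaller degree, up to a factor of two. -/
theorem exists_subgraph_degree_mem_Icc {H : SimpleGraph V} {d : ℕ}
    (hH : ∀ v, H.degree v = d) {k : ℕ} (hk : k ≤ d) :
    ∃ R ≤ H, ∀ v, k ≤ R.degree v ∧ R.degree v ≤ 2 * k := by
  obtain ⟨j, rfl⟩ := Nat.exists_eq_add_of_le hk
  obtain ⟨t, ht, h1, h2⟩ := exists_regular_subset (k := k) j (t := fun v => H.neighborFinset v)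
    (by simpa using hH) (fun u => by
      rw [← hH u, ← H.card_neighborFinset_eq_degree]
      congr 1
      ext v
      simp [H.adj_comm])
  have hirr : ∀ v, v ∉ t v := fun v h => by simpa using ht v h
  -- Symmetrizing a relation with in- and out-degrees `k` gives degrees between `k` and `2 * k`.
  let R : SimpleGraph V :=
    { Adj := fun u v => v ∈ t u ∨ u ∈ t v
      symm := ⟨fun _ _ h => h.symm⟩
      loopless := ⟨fun v h => hirr v (h.elim id id)⟩ }
  have hR : ∀ v [Fintype (R.neighborSet v)],
      R.degree v = #(t v ∪ ({u | v ∈ t u} : Finset V)) := by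
    intro v _
    rw [← R.card_neighborFinset_eq_degree]
    congr 1
    ext u
    simp [R]
  refine ⟨R, ?_, fun v => ⟨?_, ?_⟩⟩
  · rintro u v (h | h)
    · simpa using ht u h
    · simpa using (H.mem_neighborFinset _ _).1 (ht v h) |>.symm
  · rw [hR, ← h1 v]
    exact card_le_card subset_union_left
  · rw [hR]
    refine (card_union_le _ _).trans ?_
    rw [h1, h2]
    omega

end SparseSubgraph

/-! ### Probability bounds for random vectors -/

section RandomVectors

variable {E : Type*} [Fintype E] [DecidableEq E] {d : ℕ}

/-- Shifting one coordinate in `T` by `a` turns sum zero into sum `a`, so all values of the sum are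
equally likely. -/
theorem card_sum_eq_zero_mul_le {A : Type*} [AddCommGroup A] [Fintype A] [DecidableEq A]
    {T : Finset E} (hT : T.Nonempty) :
    #{f : E → A | ∑ e ∈ T, f e = 0} * Fintype.card A ≤ Fintype.card (E → A) := by
  obtain ⟨e₀, he₀⟩ := hT
  have hsum : ∀ (f : E → A) a, ∑ e ∈ T, f e = 0 →
      ∑ e ∈ T, (f + Pi.single e₀ a : E → A) e = a := by
    intro f a hf
    simp only [Pi.add_apply, sum_add_distrib, hf, zero_add]
    rw [sum_pi_single' e₀ a T]
    simp [he₀]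
  rw [← Finset.card_univ, ← Finset.card_univ, ← card_product]
  refine card_le_card_of_injOn (fun x => x.1 + Pi.single e₀ x.2) (fun _ _ => by simp) ?_
  rintro ⟨f, a⟩ hf ⟨g, b⟩ hg h
  simp only [coe_product, Set.mem_prod, mem_coe, mem_filter_univ] at hf hg h
  have hab : a = b := by rw [← hsum f a hf.1, ← hsum g b hg.1, h]
  subst hab
  simpa using h

theorem card_mul_le_of_exists_sum_eq_zero {A : Type*} [AddCommGroup A] [Fintype A]
    [DecidableEq A] (S : Finset E) (F : Finset (E → A))
    (hF : ∀ f ∈ F, ∃ T ⊆ S, T.Nonempty ∧ ∑ e ∈ T, f e = 0) :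
    #F * Fintype.card A ≤ 2 ^ #S * Fintype.card (E → A) := by
  have hcover : F ⊆
      (S.powerset.filter (·.Nonempty)).biUnion fun T => {f : E → A | ∑ e ∈ T, f e = 0} := by
    intro f hf
    obtain ⟨T, h1, h2, h3⟩ := hF f hf
    simp only [mem_biUnion, mem_filter, mem_powerset, mem_univ, true_and]
    exact ⟨T, ⟨h1, h2⟩, h3⟩
  refine (Nat.mul_le_mul_right _ ((card_le_card hcover).trans card_biUnion_le)).trans ?_
  rw [sum_mul, ← card_powerset, ← smul_eq_mul]
  refine (sum_le_card_nsmul _ _ _ fun T hT =>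
    card_sum_eq_zero_mul_le (mem_filter.1 hT).2).trans ?_
  exact Nat.mul_le_mul_right _ (card_filter_le _ _)

/-- Adding a unit vector at a coordinate where `y` is nonzero moves the hyperplane into its
complement. -/
theorem two_mul_card_dotProduct_eq_zero_le {y : Fin d → ZMod 2} (hy : y ≠ 0) :
    2 * #{a : Fin d → ZMod 2 | y ⬝ᵥ a = 0} ≤ 2 ^ d := by
  obtain ⟨j, hj⟩ := Function.ne_iff.1 hy
  have h : #{a : Fin d → ZMod 2 | y ⬝ᵥ a = 0} ≤ #{a : Fin d → ZMod 2 | ¬ y ⬝ᵥ a = 0} := by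
    refine card_le_card_of_injOn (· + Pi.single j 1) ?_ (fun a _ b _ h => by simpa using h)
    intro a ha
    simp only [mem_coe, mem_filter_univ] at ha ⊢
    rw [dotProduct_add, ha, zero_add, dotProduct_single, mul_one]
    exact hj
  have h2 := card_filter_add_card_filter_not (s := (univ : Finset (Fin d → ZMod 2)))
    (fun a => y ⬝ᵥ a = 0)
  rw [Finset.card_univ, Fintype.card_pi_const, ZMod.card] at h2
  omega

theorem card_forall_dotProduct_eq_zero_mul_le {y : Fin d → ZMod 2} (hy : y ≠ 0) (S : Finset E) :
    #{f : E → Fin d → ZMod 2 | ∀ e ∈ S, y ⬝ᵥ f e = 0} * 2 ^ #S ≤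
      Fintype.card (E → Fin d → ZMod 2) := by
  have h : ({f : E → Fin d → ZMod 2 | ∀ e ∈ S, y ⬝ᵥ f e = 0} : Finset _) =
      Fintype.piFinset fun e => if e ∈ S then ({a | y ⬝ᵥ a = 0} : Finset _) else univ := by
    ext f
    simp only [mem_filter_univ, Fintype.mem_piFinset]
    refine forall_congr' fun e => ?_
    by_cases he : e ∈ S <;> simp [he]
  have h2 : (2 : ℕ) ^ #S = ∏ e : E, if e ∈ S then 2 else 1 := by simp
  rw [h, Fintype.card_piFinset, h2, ← prod_mul_distrib, Fintype.card_pi]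
  refine prod_le_prod' fun e _ => ?_
  rw [Fintype.card_pi_const, ZMod.card]
  by_cases he : e ∈ S
  · simpa [he, mul_comm] using two_mul_card_dotProduct_eq_zero_le hy
  · simp [he]

theorem card_mul_le_of_exists_dotProduct_eq_zero (S : Finset E)
    (F : Finset (E → Fin d → ZMod 2)) (hF : ∀ f ∈ F, ∃ y ≠ 0, ∀ e ∈ S, y ⬝ᵥ f e = 0) :
    #F * 2 ^ #S ≤ 2 ^ d * Fintype.card (E → Fin d → ZMod 2) := by
  have hcover : F ⊆
      (univ.filter (· ≠ (0 : Fin d → ZMod 2))).biUnion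
        fun y => {f : E → Fin d → ZMod 2 | ∀ e ∈ S, y ⬝ᵥ f e = 0} := by
    intro f hf
    simp only [mem_filter_univ, mem_biUnion]
    exact hF f hf
  refine (Nat.mul_le_mul_right _ ((card_le_card hcover).trans card_biUnion_le)).trans ?_
  have hc : (2 : ℕ) ^ d = #(univ : Finset (Fin d → ZMod 2)) := by
    rw [Finset.card_univ, Fintype.card_pi_const, ZMod.card]
  rw [sum_mul, hc, ← smul_eq_mul]
  refine (sum_le_card_nsmul _ _ (Fintype.card (E → Fin d → ZMod 2)) fun y hy => ?_).trans
    (Nat.mul_le_mul_right _ (card_filter_le _ _))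
  exact card_forall_dotProduct_eq_zero_mul_le (mem_filter_univ y |>.1 hy) S

end RandomVectors

/-! ### Greedy completion to local bases -/

section Completion

variable {V : Type*} [DecidableEq V] {d : ℕ}

/-- The vectors assigned to the edges in `F` at any given vertex are linearly independent
over the field with two elements. -/
def LocallyIndependent (F : Finset (Sym2 V)) (f : Sym2 V → Fin d → ZMod 2) : Prop :=
  ∀ v, ∀ T ⊆ F, (∀ e ∈ T, v ∈ e) → ∑ e ∈ T, f e = 0 → T = ∅

/-- At each end of `e` the subset sums fill at most half of the space. Both sets of sums contain
`0`, so together they miss some vector. -/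
theorem LocallyIndependent.exists_insert {F : Finset (Sym2 V)} {f : Sym2 V → Fin d → ZMod 2}
    (hf : LocallyIndependent F f) {e : Sym2 V} (he : e ∉ F)
    (hdeg : ∀ v ∈ e, #{x ∈ F | v ∈ x} < d) :
    ∃ a, LocallyIndependent (insert e F) (Function.update f e a) := by
  set span : V → Finset (Fin d → ZMod 2) := fun v =>
    {x ∈ F | v ∈ x}.powerset.image fun T => ∑ x ∈ T, f x with hspan
  have hspan0 : ∀ v, 0 ∈ span v := fun v => mem_image.2 ⟨∅, by simp, by simp⟩
  have hspanc : ∀ v ∈ e, 2 * #(span v) ≤ 2 ^ d := by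
    intro v hv
    have h1 : #(span v) ≤ 2 ^ #{x ∈ F | v ∈ x} := card_image_le.trans (card_powerset _).le
    have h2 : 2 ^ (#{x ∈ F | v ∈ x} + 1) ≤ 2 ^ d := Nat.pow_le_pow_right two_pos (hdeg v hv)
    rw [pow_succ] at h2
    omega
  have hex : ∃ a, ∀ v ∈ e, a ∉ span v := by
    induction e using Sym2.ind with
    | _ u v =>
    by_contra! hcon
    have hcov : (univ : Finset (Fin d → ZMod 2)) ⊆ span u ∪ span v := by
      intro a _
      obtain ⟨w, hw, ha⟩ := hcon a
      rw [mem_union]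
      rcases Sym2.mem_iff.1 hw with rfl | rfl
      · exact Or.inl ha
      · exact Or.inr ha
    have h1 := card_le_card hcov
    have h2 := card_union_add_card_inter (span u) (span v)
    have h3 : 0 < #(span u ∩ span v) := card_pos.2 ⟨0, mem_inter.2 ⟨hspan0 u, hspan0 v⟩⟩
    have h4 := hspanc u (Sym2.mem_mk_left u v)
    have h5 := hspanc v (Sym2.mem_mk_right u v)
    rw [Finset.card_univ, Fintype.card_pi_const, ZMod.card] at h1
    omega
  obtain ⟨a, ha⟩ := hex
  refine ⟨a, fun v T hT hv hsum => ?_⟩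
  have hupd : ∀ T' ⊆ F, ∑ x ∈ T', Function.update f e a x = ∑ x ∈ T', f x := fun T' hT' =>
    sum_congr rfl fun x hx => Function.update_of_ne (ne_of_mem_of_not_mem (hT' hx) he) _ _
  by_cases heT : e ∈ T
  · exfalso
    have hTF : T.erase e ⊆ F := fun x hx =>
      (mem_insert.1 (hT (mem_of_mem_erase hx))).resolve_left (ne_of_mem_erase hx)
    rw [← add_sum_erase _ _ heT, hupd _ hTF, Function.update_self] at hsum
    refine ha v (hv e heT) (mem_image.2 ⟨T.erase e, ?_, ?_⟩)
    · exact mem_powerset.2 fun x hx => mem_filter.2 ⟨hTF hx, hv x (mem_of_mem_erase hx)⟩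
    · rw [eq_neg_of_add_eq_zero_left hsum, ZModModule.neg_eq_self]
  · have hTF : T ⊆ F := (subset_insert_iff_of_notMem heT).1 hT
    exact hf v T hTF hv (by rw [← hsum, hupd T hTF])

/-- Since no vector space is a union of two proper subspaces, vectors can be assigned greedily
to the remaining edges. -/
theorem LocallyIndependent.exists_extend {F : Finset (Sym2 V)} {f : Sym2 V → Fin d → ZMod 2}
    (hf : LocallyIndependent F f) (F' : Finset (Sym2 V)) (hdisj : Disjoint F F')
    (hdeg : ∀ v, #{x ∈ F ∪ F' | v ∈ x} ≤ d) :
    ∃ g : Sym2 V → Fin d → ZMod 2, (∀ e ∈ F, g e = f e) ∧ LocallyIndependent (F ∪ F') g := by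
  induction F' using Finset.induction_on with
  | empty => exact ⟨f, fun _ _ => rfl, by simpa using hf⟩
  | insert e F' he ih =>
    rw [disjoint_insert_right] at hdisj
    rw [union_insert] at hdeg ⊢
    have heu : e ∉ F ∪ F' := by simp [he, hdisj.1]
    obtain ⟨g, hgf, hg⟩ := ih hdisj.2 fun v =>
      (card_le_card (filter_subset_filter _ (subset_insert _ _))).trans (hdeg v)
    obtain ⟨a, ha⟩ := hg.exists_insert heu fun v hv => by
      refine lt_of_lt_of_le ?_ (hdeg v)
      rw [filter_insert, if_pos hv, card_insert_of_notMem fun h => heu (mem_filter.1 h).1]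
      exact Nat.lt_succ_self _
    refine ⟨_, fun x hx => ?_, ha⟩
    rw [Function.update_of_ne (ne_of_mem_of_not_mem hx hdisj.1), hgf x hx]

/-- By independence the `2 ^ d` subset sums at `v` are distinct, too many for the hyperplane
orthogonal to `y`. -/
theorem LocallyIndependent.exists_dotProduct_ne_zero {F : Finset (Sym2 V)}
    {f : Sym2 V → Fin d → ZMod 2} (hf : LocallyIndependent F f) {v : V}
    (hdeg : #{x ∈ F | v ∈ x} = d) {y : Fin d → ZMod 2} (hy : y ≠ 0) :
    ∃ e ∈ F, v ∈ e ∧ y ⬝ᵥ f e ≠ 0 := by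
  by_contra! hcon
  have hcard : #{x ∈ F | v ∈ x}.powerset ≤ #{a : Fin d → ZMod 2 | y ⬝ᵥ a = 0} := by
    refine card_le_card_of_injOn (fun T => ∑ x ∈ T, f x) ?_ ?_
    · intro T hT
      simp only [mem_coe, mem_powerset, mem_filter_univ] at hT ⊢
      rw [dotProduct_sum]
      refine sum_eq_zero fun x hx => ?_
      obtain ⟨h1, h2⟩ := mem_filter.1 (hT hx)
      exact hcon x h1 h2
    · intro T hT T' hT' h
      simp only [mem_coe, mem_powerset] at hT hT' h
      have hsub : symmDiff T T' ⊆ {x ∈ F | v ∈ x} := fun x hx => by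
        rcases mem_symmDiff.1 hx with hx | hx
        · exact hT hx.1
        · exact hT' hx.1
      have h0 : symmDiff T T' = ∅ := by
        refine hf v _ (hsub.trans (filter_subset _ _)) (fun x hx => (mem_filter.1 (hsub hx)).2) ?_
        have hd : Disjoint (T \ T') (T' \ T) := disjoint_sdiff_sdiff
        have h1 := sum_inter_add_sum_sdiff T T' f
        have h2 := sum_inter_add_sum_sdiff T' T f
        rw [inter_comm] at h2
        rw [symmDiff_def, sup_eq_union, sum_union hd]
        have h3 : ∑ x ∈ T \ T', f x = ∑ x ∈ T' \ T, f x := by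
          rw [← h1, ← h2] at h
          exact add_left_cancel h
        rw [h3, ZModModule.add_self]
      exact symmDiff_eq_bot.1 h0
  have h2 := two_mul_card_dotProduct_eq_zero_le hy
  rw [card_powerset, hdeg] at hcard
  have := Nat.two_pow_pos d
  omega

end Completion

/-! ### Edge boundaries -/

section Cut

variable {V : Type*} [Fintype V] [DecidableEq V]

open scoped Classical in
/-- The edges of `G` between `W` and its complement. -/
noncomputable def cut (G : SimpleGraph V) (W : Finset V) : Finset (Sym2 V) :=
  (G.interedges W Wᶜ).image fun x => s(x.1, x.2)

theorem mem_cut {G : SimpleGraph V} {W : Finset V} {e : Sym2 V} :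
    e ∈ cut G W ↔ ∃ a ∈ W, ∃ b ∉ W, G.Adj a b ∧ s(a, b) = e := by
  simp only [cut, mem_image, SimpleGraph.mem_interedges_iff, mem_compl, Prod.exists]
  constructor
  · rintro ⟨a, b, ⟨ha, hb, h⟩, he⟩
    exact ⟨a, ha, b, hb, h, he⟩
  · rintro ⟨a, ha, b, hb, h, he⟩
    exact ⟨a, b, ⟨ha, hb, h⟩, he⟩

theorem card_cut (G : SimpleGraph V) [DecidableRel G.Adj] (W : Finset V) :
    #(cut G W) = ∑ a ∈ W, #{b ∈ Wᶜ | G.Adj a b} := by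
  rw [cut, card_image_of_injOn]
  · rw [SimpleGraph.interedges_def, card_filter, sum_product]
    refine sum_congr rfl fun a _ => ?_
    rw [card_filter]
    exact sum_congr rfl fun b _ => by congr
  · rintro ⟨a, b⟩ h ⟨a', b'⟩ h' hab
    simp only [mem_coe, SimpleGraph.mem_interedges_iff, mem_compl] at h h'
    rcases Sym2.eq_iff.1 hab with ⟨rfl, rfl⟩ | ⟨rfl, rfl⟩
    · rfl
    · exact absurd h.1 h'.2.1

theorem card_interedges_compl (G : SimpleGraph V) [DecidableRel G.Adj] (W : Finset V) :
    #(G.interedges W Wᶜ) = #(cut G W) := by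
  rw [card_cut, SimpleGraph.interedges_def, card_filter, sum_product]
  refine sum_congr rfl fun a _ => ?_
  rw [card_filter]

theorem cut_mono {G G' : SimpleGraph V} (h : G ≤ G') (W : Finset V) : cut G W ⊆ cut G' W := by
  intro e he
  obtain ⟨a, ha, b, hb, hab, rfl⟩ := mem_cut.1 he
  exact mem_cut.2 ⟨a, ha, b, hb, h hab, rfl⟩

theorem card_cut_le_of_degree_le (G : SimpleGraph V) [DecidableRel G.Adj] {m : ℕ}
    (hG : ∀ v, G.degree v ≤ m) (W : Finset V) : #(cut G W) ≤ #W * m := by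
  rw [card_cut, ← smul_eq_mul]
  refine sum_le_card_nsmul _ _ _ fun a _ => (card_le_card fun b hb => ?_).trans (hG a)
  exact (G.mem_neighborFinset _ _).2 (mem_filter.1 hb).2

/-- A vertex of `W` has at most `#W - 1` neighbours inside `W`. -/
theorem le_card_cut_of_le_degree (G : SimpleGraph V) [DecidableRel G.Adj] {m : ℕ}
    (hG : ∀ v, m ≤ G.degree v) (W : Finset V) : #W * (m + 1 - #W) ≤ #(cut G W) := by
  rw [card_cut, ← smul_eq_mul]
  refine card_nsmul_le_sum _ _ _ fun a ha => ?_
  have h : G.neighborFinset a ⊆ {b ∈ Wᶜ | G.Adj a b} ∪ W.erase a := by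
    intro b hb
    have hab := (G.mem_neighborFinset _ _).1 hb
    by_cases hbW : b ∈ W
    · exact mem_union_right _ (mem_erase.2 ⟨hab.ne', hbW⟩)
    · exact mem_union_left _ (mem_filter.2 ⟨mem_compl.2 hbW, hab⟩)
  have h1 := (card_le_card h).trans (card_union_le _ _)
  rw [G.card_neighborFinset_eq_degree, card_erase_of_mem ha] at h1
  have := hG a
  have := card_pos.2 ⟨a, ha⟩
  omega

theorem cut_subset_union_sdiff (G R : SimpleGraph V) (W : Finset V) :
    cut G W ⊆ cut (G \ R) W ∪ cut R W := by
  intro e he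
  obtain ⟨a, ha, b, hb, hab, rfl⟩ := mem_cut.1 he
  by_cases hR : R.Adj a b
  · exact mem_union_right _ (mem_cut.2 ⟨a, ha, b, hb, hR, rfl⟩)
  · exact mem_union_left _ (mem_cut.2 ⟨a, ha, b, hb, ⟨hab, hR⟩, rfl⟩)

theorem mem_cut_singleton {G : SimpleGraph V} {v : V} {e : Sym2 V} (he : e ∈ G.edgeSet)
    (hv : v ∈ e) : e ∈ cut G {v} := by
  induction e using Sym2.ind with
  | _ a b =>
  rw [SimpleGraph.mem_edgeSet] at he
  rcases Sym2.mem_iff.1 hv with rfl | rfl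
  · exact mem_cut.2 ⟨v, by simp, b, by simpa using he.ne', he, rfl⟩
  · exact mem_cut.2 ⟨v, by simp, a, by simpa using he.ne, he.symm, Sym2.eq_swap⟩

end Cut

/-! ### Applying the local lemma -/

section RandomAssignment

variable {V : Type*} [Fintype V] [DecidableEq V]

theorem le_half_pow_mul {x N a b m : ℕ} (h : x * 2 ^ a ≤ 2 ^ b * N) (hab : b + m ≤ a) :
    (x : ℝ) ≤ (1 / 2) ^ m * N := by
  have h1 : (x : ℝ) * 2 ^ (b + m) ≤ 2 ^ b * N := by
    have h2 : x * 2 ^ (b + m) ≤ 2 ^ b * N :=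
      (Nat.mul_le_mul_left _ (Nat.pow_le_pow_right two_pos hab)).trans h
    exact_mod_cast h2
  rw [one_div, inv_pow, ← div_eq_inv_mul, le_div_iff₀ (by positivity)]
  rw [pow_add] at h1
  have : (0 : ℝ) < 2 ^ b := by positivity
  nlinarith

-- The local lemma condition for `q = 1 - 1 / (2 * d)`. By Bernoulli `q ^ d ≥ 1 / 2`, so a term is
-- at most `x ^ #W` with `x = 2 / d ^ 8`. A boundary containing `e` comes from a set containing an
-- end of `e`, so the sum is at most `4 * x ≤ 1 / (2 * d)`.
open scoped Classical in
theorem sum_half_pow_div_le (G H : SimpleGraph V) {d L : ℕ} (hd : 2 ≤ d) (hL : d ≤ 2 ^ L)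
    (hH : ∀ v, H.degree v ≤ d) (hG : ∀ v, G.degree v ≤ d) (I : Finset (Finset V))
    (hI : ∀ W ∈ I, (H.induce (W : Set V)).Connected) (e : Sym2 V) :
    ∑ W ∈ I with e ∈ cut G W, (1 / 2 : ℝ) ^ (8 * L * #W) / (1 - 1 / (2 * d)) ^ #(cut G W) ≤
      1 - (1 - 1 / (2 * d)) := by
  have hdR : (2 : ℝ) ≤ d := by exact_mod_cast hd
  have hq0 : (0 : ℝ) ≤ 1 / (2 * d) := by positivity
  have hqd : (1 / 2 : ℝ) ≤ (1 - 1 / (2 * d)) ^ d := by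
    have h := one_add_mul_le_pow (a := -(1 / (2 * d) : ℝ)) (by
      have : (1 : ℝ) / (2 * d) ≤ 1 := by
        rw [div_le_one (by positivity)]
        linarith
      linarith) d
    have h2 : (1 : ℝ) + d * -(1 / (2 * d)) = 1 / 2 := by field_simp; norm_num
    rw [h2, ← sub_eq_add_neg] at h
    exact h
  have hq1 : (0 : ℝ) < 1 - 1 / (2 * d) := by
    by_contra! h
    have : (1 : ℝ) / (2 * d) ≤ 1 / 4 := by gcongr; linarith
    linarith
  set q : ℝ := 1 - 1 / (2 * d) with hq
  set x : ℝ := 2 / d ^ 8 with hx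
  have hx0 : 0 ≤ x := by positivity
  have hterm : ∀ W : Finset V, (1 / 2 : ℝ) ^ (8 * L * #W) / q ^ #(cut G W) ≤ x ^ #W := by
    intro W
    have h1 : #(cut G W) ≤ d * #W := by
      rw [mul_comm]
      exact card_cut_le_of_degree_le G hG W
    have h2 : (1 / 2 : ℝ) ^ #W ≤ q ^ #(cut G W) := by
      calc (1 / 2 : ℝ) ^ #W ≤ (q ^ d) ^ #W := by gcongr
        _ = q ^ (d * #W) := by rw [pow_mul]
        _ ≤ _ := pow_le_pow_of_le_one hq1.le (by linarith) h1
    have h3 : (1 / 2 : ℝ) ^ (8 * L * #W) ≤ ((1 / d : ℝ) ^ 8) ^ #W := by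
      have : (1 / 2 : ℝ) ^ L ≤ 1 / d := by
        rw [one_div_pow]
        have : (d : ℝ) ≤ 2 ^ L := by exact_mod_cast hL
        gcongr
      calc (1 / 2 : ℝ) ^ (8 * L * #W) = (((1 / 2 : ℝ) ^ L) ^ 8) ^ #W := by
            rw [← pow_mul, ← pow_mul]
            congr 1
            ring
        _ ≤ _ := by gcongr
    rw [div_le_iff₀ (pow_pos hq1 _)]
    calc _ ≤ ((1 / d : ℝ) ^ 8) ^ #W := h3
      _ = x ^ #W * (1 / 2) ^ #W := by
          rw [← mul_pow]
          congr 1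
          rw [hx]
          field_simp
      _ ≤ _ := by gcongr
  have hd7 : (16 : ℝ) ≤ d ^ 6 := by
    calc (16 : ℝ) ≤ 2 ^ 6 := by norm_num
      _ ≤ _ := by gcongr
  have hdx : (d : ℝ) ^ 2 * x ≤ 1 / 2 := by
    have : (d : ℝ) ^ 2 * x = 2 / d ^ 6 := by rw [hx]; field_simp
    rw [this, div_le_div_iff₀ (by positivity) (by positivity)]
    linarith
  have h4x : 4 * x ≤ 1 - q := by
    rw [hq, hx, sub_sub_cancel, mul_div_assoc', div_le_div_iff₀ (by positivity) (by positivity)]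
    have h8 : (d : ℝ) ^ 8 = d * (d * d ^ 6) := by ring
    have : (16 : ℝ) ≤ d * d ^ 6 := by nlinarith
    rw [h8]
    nlinarith
  have hvert : ∀ v, ∑ W ∈ I with v ∈ W, x ^ #W ≤ 2 * x := by
    intro v
    refine sum_pow_card_le H hH _ v (fun W hW => ?_) hx0 hdx
    obtain ⟨h1, h2⟩ := mem_filter.1 hW
    exact ⟨h2, hI W h1⟩
  induction e using Sym2.ind with
  | _ a b =>
  calc ∑ W ∈ I with s(a, b) ∈ cut G W, (1 / 2 : ℝ) ^ (8 * L * #W) / q ^ #(cut G W)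
      ≤ ∑ W ∈ I with s(a, b) ∈ cut G W, x ^ #W := sum_le_sum fun W _ => hterm W
    _ ≤ ∑ W ∈ (I.filter (a ∈ ·)) ∪ (I.filter (b ∈ ·)), x ^ #W := by
        refine sum_le_sum_of_subset_of_nonneg (fun W hW => ?_) fun _ _ _ => pow_nonneg hx0 _
        obtain ⟨h1, h2⟩ := mem_filter.1 hW
        obtain ⟨u, hu, v, hv, -, h3⟩ := mem_cut.1 h2
        rcases Sym2.eq_iff.1 h3 with ⟨rfl, rfl⟩ | ⟨rfl, rfl⟩
        · exact mem_union_left _ (mem_filter.2 ⟨h1, hu⟩)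
        · exact mem_union_right _ (mem_filter.2 ⟨h1, hu⟩)
    _ ≤ (∑ W ∈ I with a ∈ W, x ^ #W) + ∑ W ∈ I with b ∈ W, x ^ #W := by
        rw [← sum_union_inter]
        exact le_add_of_nonneg_right (sum_nonneg fun _ _ => pow_nonneg hx0 _)
    _ ≤ 1 - q := by linarith [hvert a, hvert b]

open scoped Classical in
/-- If all connected sets have large boundary in `G`, there is an assignment of vectors to the
edges of `G` that is independent at every vertex and spanning on every boundary of a connected
set of at least two and at most half of the vertices. -/
theorem exists_locallyIndependent_spanning (G H : SimpleGraph V) {d L : ℕ}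
    (hd : 2 ≤ d) (hL : d ≤ 2 ^ L) (hV : 2 ≤ Fintype.card V) (hH : ∀ v, H.degree v ≤ d)
    (hG0 : ∀ v, 0 < G.degree v) (hG1 : ∀ v, G.degree v + 8 * L ≤ d)
    (hcut : ∀ W : Finset V, (H.induce (W : Set V)).Connected → 2 ≤ #W →
      2 * #W ≤ Fintype.card V → d + 8 * L * #W ≤ #(cut G W)) :
    ∃ f : Sym2 V → Fin d → ZMod 2, LocallyIndependent G.edgeFinset f ∧
      ∀ W : Finset V, (H.induce (W : Set V)).Connected → 2 ≤ #W →
        2 * #W ≤ Fintype.card V → ∀ y ≠ 0, ∃ e ∈ cut G W, y ⬝ᵥ f e ≠ 0 := by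
  have hdR : (2 : ℝ) ≤ d := by exact_mod_cast hd
  set I : Finset (Finset V) :=
    {W | (H.induce (W : Set V)).Connected ∧ 1 ≤ #W ∧ 2 * #W ≤ Fintype.card V} with hI
  -- Bad events: dependence at a single vertex, failure to span on a larger boundary.
  set B : Finset V → (Sym2 V → Fin d → ZMod 2) → Prop := fun W f =>
    if #W = 1 then ∃ T ⊆ cut G W, T.Nonempty ∧ ∑ e ∈ T, f e = 0
    else ∃ y ≠ 0, ∀ e ∈ cut G W, y ⬝ᵥ f e = 0 with hB
  have hsingle : ∀ v, #(cut G {v}) = G.degree v := by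
    intro v
    refine le_antisymm ?_ ?_
    · rw [card_cut, sum_singleton]
      refine card_le_card fun b hb => ?_
      exact (G.mem_neighborFinset _ _).2 (mem_filter.1 hb).2
    · rw [card_cut, sum_singleton]
      refine card_le_card fun b hb => ?_
      have hb := (G.mem_neighborFinset _ _).1 hb
      exact mem_filter.2 ⟨by simpa using hb.ne', hb⟩
  have hex : ∃ f, ∀ W ∈ I, ¬ B W f := by
    refine exists_forall_not_of_sum_le I (cut G) B ?_ ?_
      (fun W => (1 / 2 : ℝ) ^ (8 * L * #W)) ?_ (q := 1 - 1 / (2 * d)) ?_ ?_ ?_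
    · intro W _ f g hfg hBf
      simp only [hB] at hBf ⊢
      split_ifs at hBf ⊢ with h1
      · obtain ⟨T, hT, hne, hs⟩ := hBf
        exact ⟨T, hT, hne, by rw [← hs]; exact sum_congr rfl fun e he => (hfg e (hT he)).symm⟩
      · obtain ⟨y, hy, h⟩ := hBf
        exact ⟨y, hy, fun e he => by rw [← hfg e he]; exact h e he⟩
    · intro W hW
      rw [hI, mem_filter_univ] at hW
      rw [← card_pos]
      rcases hW.2.1.eq_or_lt with h1 | h1
      · obtain ⟨v, rfl⟩ := card_eq_one.1 h1.symm
        rw [hsingle]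
        exact hG0 v
      · have := hcut W hW.1 h1 hW.2.2
        omega
    · intro W hW F hF
      rw [hI, mem_filter_univ] at hW
      rcases hW.2.1.eq_or_lt with h1 | h1
      · obtain ⟨v, rfl⟩ := card_eq_one.1 h1.symm
        have h := card_mul_le_of_exists_sum_eq_zero (cut G {v}) F fun f hf => by
          simpa only [hB, card_singleton, if_true] using hF f hf
        rw [Fintype.card_pi_const (ZMod 2), ZMod.card] at h
        refine le_half_pow_mul h ?_
        rw [hsingle, card_singleton]
        have := hG1 v
        omega
      · have h := card_mul_le_of_exists_dotProduct_eq_zero (cut G W) F fun f hf => by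
          simpa only [hB, if_neg (show ¬ #W = 1 by omega)] using hF f hf
        exact le_half_pow_mul h (hcut W hW.1 h1 hW.2.2)
    · have : (1 : ℝ) / (2 * d) < 1 := by
        rw [div_lt_one (by positivity)]
        linarith
      linarith
    · have : (0 : ℝ) ≤ 1 / (2 * d) := by positivity
      linarith
    · exact sum_half_pow_div_le G H hd hL hH (fun v => by have := hG1 v; omega) I
        fun W hW => ((mem_filter_univ W).1 hW).1
  obtain ⟨f, hf⟩ := hex
  refine ⟨f, ?_, ?_⟩
  · intro v T hT hv hsum
    by_contra hne
    have hvI : {v} ∈ I := by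
      rw [hI, mem_filter_univ]
      refine ⟨?_, by simp, by simpa using hV⟩
      rw [coe_singleton]
      exact SimpleGraph.Connected.of_subsingleton
    refine hf {v} hvI ?_
    simp only [hB, card_singleton, if_true]
    exact ⟨T, fun e he => mem_cut_singleton (SimpleGraph.mem_edgeFinset.1 (hT he)) (hv e he),
      nonempty_iff_ne_empty.2 hne, hsum⟩
  · intro W hW h2 hn y hy
    have hWI : W ∈ I := by
      rw [hI, mem_filter_univ]
      exact ⟨hW, by omega, hn⟩
    have := hf W hWI
    simp only [hB, if_neg (show ¬ #W = 1 by omega)] at this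
    push Not at this
    exact this y hy

end RandomAssignment

/-! ### From vector assignments to codes -/

section Codewords

variable {V : Type*} {d : ℕ}

/-- The spanning subgraph of `H` of all edges whose vector is not orthogonal to `y`. -/
def codeword (H : SimpleGraph V) (f : Sym2 V → Fin d → ZMod 2) (y : Fin d → ZMod 2) :
    SimpleGraph V where
  Adj u v := H.Adj u v ∧ y ⬝ᵥ f s(u, v) ≠ 0
  symm := ⟨fun u v h => ⟨h.1.symm, by rw [Sym2.eq_swap]; exact h.2⟩⟩
  loopless := ⟨fun v h => H.loopless.irrefl v h.1⟩

theorem codeword_le (H : SimpleGraph V) (f : Sym2 V → Fin d → ZMod 2) (y : Fin d → ZMod 2) :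
    codeword H f y ≤ H := fun _ _ h => h.1

theorem codeword_zero (H : SimpleGraph V) (f : Sym2 V → Fin d → ZMod 2) :
    codeword H f 0 = ⊥ := by
  ext u v
  simp [codeword]

theorem symmDiff_codeword (H : SimpleGraph V) (f : Sym2 V → Fin d → ZMod 2)
    (y z : Fin d → ZMod 2) :
    symmDiff (codeword H f y) (codeword H f z) = codeword H f (y + z) := by
  have key : ∀ a b : ZMod 2, (a ≠ 0 ∧ ¬ b ≠ 0 ∨ b ≠ 0 ∧ ¬ a ≠ 0) ↔ a + b ≠ 0 := by decide
  ext u v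
  simp only [symmDiff_def, SimpleGraph.sup_adj, SimpleGraph.sdiff_adj, codeword, add_dotProduct,
    ← key]
  tauto

variable [Fintype V]

open scoped Classical in
/-- If every connected set of at most half of the vertices has a boundary edge with vector not
orthogonal to `y`, then the codeword of `y` is connected. -/
theorem connected_codeword [DecidableEq V] [Nonempty V] {H : SimpleGraph V} {f : Sym2 V → Fin d → ZMod 2}
    {y : Fin d → ZMod 2}
    (h : ∀ W : Finset V, (H.induce (W : Set V)).Connected → 2 * #W ≤ Fintype.card V →
      ∃ e ∈ cut H W, y ⬝ᵥ f e ≠ 0) : (codeword H f y).Connected := by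
  -- A component with at most half the vertices is connected in `H`, so a boundary edge not
  -- orthogonal to `y` would leave it. Two components larger than half must meet.
  have hlarge : ∀ u, Fintype.card V < 2 * #{x | (codeword H f y).Reachable u x} := by
    intro u
    by_contra! hcon
    have hconn : (H.induce (({x | (codeword H f y).Reachable u x} : Finset V) : Set V)).Connected := by
      refine SimpleGraph.Connected.mono
        (SimpleGraph.comap_monotone _ (codeword_le H f y)) ?_
      have := ((codeword H f y).connectedComponentMk u).connected_toSimpleGraph
      have hs : (({x | (codeword H f y).Reachable u x} : Finset V) : Set V) =
          ((codeword H f y).connectedComponentMk u).supp := by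
        ext x
        simp [SimpleGraph.ConnectedComponent.eq, SimpleGraph.reachable_comm]
      rw [hs]
      exact this
    obtain ⟨e, he, hye⟩ := h _ hconn hcon
    obtain ⟨a, ha, b, hb, hab, rfl⟩ := mem_cut.1 he
    rw [mem_filter_univ] at ha hb
    have hab' : (codeword H f y).Adj a b := ⟨hab, hye⟩
    exact hb (ha.trans hab'.reachable)
  refine SimpleGraph.Connected.mk fun u v => ?_
  have hinter : 0 < #(({x | (codeword H f y).Reachable u x} : Finset V) ∩
      ({x | (codeword H f y).Reachable v x} : Finset V)) := by
    have h1 := card_union_add_card_inter ({x | (codeword H f y).Reachable u x} : Finset V)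
      ({x | (codeword H f y).Reachable v x} : Finset V)
    have h2 := card_le_univ (({x | (codeword H f y).Reachable u x} : Finset V) ∪
      ({x | (codeword H f y).Reachable v x} : Finset V))
    have := hlarge u
    have := hlarge v
    omega
  obtain ⟨x, hx⟩ := card_pos.1 hinter
  simp only [mem_inter, mem_filter_univ] at hx
  exact hx.1.trans hx.2.symm

/-- Members with equal neighbourhoods at `v` would leave `v` isolated in their symmetric difference.
-/
theorem ncard_le_two_pow_degree [Nontrivial V] {H : SimpleGraph V} [DecidableRel H.Adj]
    {𝒢 : Set (SimpleGraph V)} (h𝒢 : IsConnectivityCode H 𝒢) (v : V) :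
    𝒢.ncard ≤ 2 ^ H.degree v := by
  classical
  rw [← H.card_neighborFinset_eq_degree, ← card_powerset, ← Set.ncard_coe_finset]
  refine Set.ncard_le_ncard_of_injOn (fun G => G.neighborFinset v) ?_ ?_ (Set.toFinite _)
  · intro G hG
    simp only [mem_coe, mem_powerset]
    intro u hu
    exact (H.mem_neighborFinset _ _).2 (h𝒢.1 G hG ((G.mem_neighborFinset _ _).1 hu))
  · intro G hG G' hG' hGG'
    by_contra hne
    obtain ⟨u, hu⟩ := (h𝒢.2 G hG G' hG' hne).preconnected.exists_adj_of_nontrivial v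
    have hiff : G.Adj v u ↔ G'.Adj v u := by
      simpa using congrArg (u ∈ ·) hGG'
    simp only [symmDiff_def, SimpleGraph.sup_adj, SimpleGraph.sdiff_adj] at hu
    tauto

theorem exists_code_of_connected_codeword [Nontrivial V] {H : SimpleGraph V} [DecidableRel H.Adj]
    (hH : ∃ v, H.degree v = d) {f : Sym2 V → Fin d → ZMod 2}
    (hf : ∀ y ≠ 0, (codeword H f y).Connected) :
    maxCodeSize H = 2 ^ d ∧
      ∃ 𝒢 : Set (SimpleGraph V), IsConnectivityCode H 𝒢 ∧ IsLinear 𝒢 ∧ 𝒢.ncard = 2 ^ d := by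
  have hne : ∀ y z : Fin d → ZMod 2, y ≠ z → y + z ≠ 0 := by
    intro y z hyz h
    exact hyz (by rw [eq_neg_of_add_eq_zero_left h, ZModModule.neg_eq_self])
  have hcode : IsConnectivityCode H (Set.range (codeword H f)) := by
    refine ⟨?_, ?_⟩
    · rintro _ ⟨y, rfl⟩
      exact codeword_le H f y
    · rintro _ ⟨y, rfl⟩ _ ⟨z, rfl⟩ hyz
      rw [symmDiff_codeword]
      exact hf _ (hne y z fun h => hyz (h ▸ rfl))
  have hinj : Function.Injective (codeword H f) := by
    intro y z hyz
    by_contra hcon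
    have h1 := hf _ (hne y z hcon)
    rw [← symmDiff_codeword, hyz, symmDiff_self] at h1
    obtain ⟨v⟩ := h1.nonempty
    obtain ⟨u, hu⟩ := h1.preconnected.exists_adj_of_nontrivial v
    exact hu
  have hlin : IsLinear (Set.range (codeword H f)) := by
    refine ⟨⟨0, codeword_zero H f⟩, ?_⟩
    rintro _ ⟨y, rfl⟩ _ ⟨z, rfl⟩
    exact ⟨y + z, (symmDiff_codeword H f y z).symm⟩
  have hcard : (Set.range (codeword H f)).ncard = 2 ^ d := by
    rw [← Set.image_univ, Set.ncard_image_of_injective _ hinj, Set.ncard_univ,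
      Nat.card_eq_fintype_card, Fintype.card_pi_const, ZMod.card]
  refine ⟨(isGreatest_maxCodeSize H).unique ⟨⟨_, hcode, hcard⟩, ?_⟩, _, hcode, hlin, hcard⟩
  rintro k ⟨𝒢, h𝒢, rfl⟩
  obtain ⟨v, rfl⟩ := hH
  exact ncard_le_two_pow_degree h𝒢 v

end Codewords

/-! ### Choice of parameters and conclusion -/

section Main

variable {V : Type*} [Fintype V] [DecidableEq V]

/-- `s` is the boundary size in `H \ R`. If `4 * w ≤ d` the minimum degree `d - 16 * L` suffices;
otherwise `d < 4 * w` and expansion does. -/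
theorem add_le_of_expansion {d L w s : ℕ} (hL : 1 ≤ L) (hLd : 128 * L ≤ d) (hw : 2 ≤ w)
    (h1 : w * (d - 16 * L + 1 - w) ≤ s) (h2 : 112 * w * L ≤ s) : d + 8 * L * w ≤ s := by
  rcases le_or_gt (4 * w) d with h | h
  · refine le_trans ?_ h1
    obtain ⟨r, hr⟩ : ∃ r, d - 16 * L + 1 - w = r := ⟨_, rfl⟩
    rw [hr]
    have h3 : 8 * r ≥ 5 * d := by omega
    have h4 : 16 * (8 * L) ≤ d := by omega
    nlinarith [Nat.mul_le_mul_left w h3, Nat.mul_le_mul_left w h4, Nat.mul_le_mul_left d hw]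
  · refine le_trans ?_ h2
    nlinarith [Nat.mul_le_mul_left w hL]

/-- A regular expander has a vector assignment all of whose nonzero codewords are connected. -/
theorem exists_connected_codeword [Nonempty V] {H : SimpleGraph V} [DecidableRel H.Adj] {d L : ℕ}
    (hd : 2 ≤ d) (hL1 : 1 ≤ L) (hL : d ≤ 2 ^ L) (hV : 2 ≤ Fintype.card V)
    (hH : H.IsRegularOfDegree d)
    (hexp : ∀ W : Finset V, (H.induce (W : Set V)).Connected → 2 * #W ≤ Fintype.card V →
      128 * #W * L ≤ #(cut H W)) :
    ∃ f : Sym2 V → Fin d → ZMod 2, ∀ y ≠ 0, (codeword H f y).Connected := by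
  classical
  -- Expansion of a single vertex, whose boundary has at most `d` edges.
  have hLd : 128 * L ≤ d := by
    obtain ⟨v⟩ := ‹Nonempty V›
    have h1 := hexp {v} (by
      rw [coe_singleton]
      exact SimpleGraph.Connected.of_subsingleton) (by simpa using hV)
    have h2 := card_cut_le_of_degree_le H (fun v => (hH v).le) {v}
    simp only [card_singleton] at h1 h2
    omega
  -- Degrees in `R` lie in `[8L, 16L]`: the lower end gives slack for independence, the upper end
  -- leaves `128 - 16 = 112` in the expansion.
  obtain ⟨R, hRH, hR⟩ := exists_subgraph_degree_mem_Icc (H := H) (d := d) (k := 8 * L)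
    (fun v => by convert hH v) (by omega)
  have hdeg : ∀ v, (H \ R).degree v + R.degree v = d := by
    intro v
    rw [← hH v, ← SimpleGraph.card_neighborFinset_eq_degree,
      ← SimpleGraph.card_neighborFinset_eq_degree, ← SimpleGraph.card_neighborFinset_eq_degree,
      ← card_union_of_disjoint]
    · congr 1
      ext u
      have := @hRH v u
      simp only [mem_union, SimpleGraph.mem_neighborFinset, SimpleGraph.sdiff_adj]
      tauto
    · rw [disjoint_left]
      intro u
      simp only [SimpleGraph.mem_neighborFinset, SimpleGraph.sdiff_adj]
      tauto
  obtain ⟨f, hf, hspan⟩ := exists_locallyIndependent_spanning (H \ R) H hd hL hV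
    (fun v => by
      have h1 : H.degree v ≤ d := (hH v).le
      convert h1)
    (fun v => by
      have h1 := hdeg v
      have h2 := hR v
      have h3 : 0 < (H \ R).degree v := by omega
      convert h3)
    (fun v => by
      have h1 := hdeg v
      have h2 := hR v
      have h3 : (H \ R).degree v + 8 * L ≤ d := by omega
      convert h3)
    (fun W hW h2 hn => by
      refine add_le_of_expansion hL1 hLd h2 ?_ ?_
      · refine le_card_cut_of_le_degree (H \ R) (fun v => ?_) W
        have h1 := hdeg v
        have h2 := hR v
        omega
      · have h3 := hexp W hW hn
        have h4 := (card_le_card (cut_subset_union_sdiff H R W)).trans (card_union_le _ _)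
        have h5 := card_cut_le_of_degree_le R (fun v => (hR v).2) W
        nlinarith)
  have hunion : (H \ R).edgeFinset ∪ R.edgeFinset = H.edgeFinset := by
    ext e
    induction e using Sym2.ind with
    | _ a b =>
    have := @hRH a b
    simp only [mem_union, SimpleGraph.mem_edgeFinset, SimpleGraph.mem_edgeSet,
      SimpleGraph.sdiff_adj]
    tauto
  have hstar : ∀ v, #{x ∈ H.edgeFinset | v ∈ x} = d := by
    intro v
    rw [← hH v, ← SimpleGraph.card_incidenceFinset_eq_degree, SimpleGraph.incidenceFinset_eq_filter]
  have hdisj : Disjoint (H \ R).edgeFinset R.edgeFinset :=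
    SimpleGraph.disjoint_edgeFinset.2 disjoint_sdiff_self_left
  obtain ⟨g, hgf, hg⟩ := LocallyIndependent.exists_extend (by convert hf) R.edgeFinset hdisj
    (fun v => by rw [hunion, hstar])
  rw [hunion] at hg
  refine ⟨g, fun y hy => connected_codeword fun W hW hn => ?_⟩
  have hpos : 0 < #W := by
    obtain ⟨v, hv⟩ := hW.nonempty
    exact card_pos.2 ⟨v, hv⟩
  rcases Nat.eq_or_lt_of_le hpos with h1 | h1
  · obtain ⟨v, rfl⟩ := card_eq_one.1 h1.symm
    obtain ⟨e, he, hve, hye⟩ := hg.exists_dotProduct_ne_zero (hstar v) hy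
    exact ⟨e, mem_cut_singleton (SimpleGraph.mem_edgeFinset.1 he) hve, hye⟩
  · obtain ⟨e, he, hye⟩ := hspan W hW h1 hn y hy
    refine ⟨e, cut_mono sdiff_le W he, ?_⟩
    rw [hgf e]
    · exact hye
    · obtain ⟨a, -, b, -, hab, rfl⟩ := mem_cut.1 he
      exact SimpleGraph.mem_edgeFinset.2 hab

end Main

end ConnCode

theorem theorem1p1 :
    ∃ c : ℝ, 0 < c ∧
      ∀ (V : Type*) [Fintype V] [DecidableEq V] [Nonempty V]
        (H : SimpleGraph V) [DecidableRel H.Adj] (d : ℕ), 2 ≤ d →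
        H.IsRegularOfDegree d →
        (∀ W : Finset V, (H.induce (W : Set V)).Connected →
          (W.card : ℝ) ≤ (Fintype.card V : ℝ) / 2 →
          c * (W.card : ℝ) * Real.logb 2 (d : ℝ) ≤ ((H.interedges W Wᶜ).card : ℝ)) →
        ConnCode.maxCodeSize H = 2 ^ d ∧
          ∃ 𝒢 : Set (SimpleGraph V), ConnCode.IsConnectivityCode H 𝒢 ∧
            ConnCode.IsLinear 𝒢 ∧ 𝒢.ncard = 2 ^ d := by
  -- `256 = 2 * 128`: rounding `log₂ d ≥ 1` up to `L = Nat.clog 2 d` at most doubles it.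
  refine ⟨256, by norm_num, ?_⟩
  intro V _ _ _ H _ d hd hH hexp
  obtain ⟨v⟩ := ‹Nonempty V›
  have hV : 2 ≤ Fintype.card V := by
    have := H.degree_lt_card_verts v
    have := hH v
    omega
  have : Nontrivial V := Fintype.one_lt_card_iff_nontrivial.1 hV
  have hlog : 1 ≤ Real.logb 2 d := by
    rw [Real.le_logb_iff_rpow_le one_lt_two (by positivity), Real.rpow_one]
    exact_mod_cast hd
  have hL : (Nat.clog 2 d : ℝ) ≤ 2 * Real.logb 2 d := by
    have h1 := Nat.ceil_lt_add_one (zero_le_one.trans hlog)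
    have h2 := Real.natCeil_logb_natCast 2 d
    rw [Nat.cast_ofNat] at h2
    rw [h2] at h1
    linarith
  obtain ⟨f, hf⟩ := ConnCode.exists_connected_codeword hd (Nat.clog_pos one_lt_two hd)
    (Nat.le_pow_clog one_lt_two d) hV hH (fun W hW hn => by
      have hn' : (W.card : ℝ) ≤ (Fintype.card V : ℝ) / 2 := by
        rw [le_div_iff₀ two_pos, mul_comm]
        exact_mod_cast hn
      have h := hexp W hW hn'
      rw [ConnCode.card_interedges_compl] at h
      have h2 : (128 * (W.card : ℝ)) * Nat.clog 2 d ≤ (128 * (W.card : ℝ)) * (2 * Real.logb 2 d) := by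
        gcongr
      have h3 : (128 * (W.card : ℝ)) * Nat.clog 2 d ≤ (ConnCode.cut H W).card := by linarith
      exact_mod_cast h3)
  exact ConnCode.exists_code_of_connected_codeword ⟨v, hH v⟩ hf
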